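/- A \emph{dimension group} is a directed, unperforated partially ordered abelian group with the Riesz interpolation property; it is \emph{simple} if it is nonzero and its only order ideals (convex directed subgroups) are $0$ and the whole group. A \emph{trace} on $G$ is a nonzero positive group homomorphism $G\to\mathbf R$, and $\tau$ is the \emph{unique} trace if every trace is a positive scalar multiple of $\tau$. For a subgroup $H$ of $G$, an \emph{equal row sum (ERS) realization of $G$ with respect to $H$} consists of positive integers $f(n)$, matrices $A_n\in \mathbf Z^{f(n+1)\times f(n)}$ with nonnegative entries, positive integers $p_{n+1}$ such that every row of $A_n$ has sum $p_{n+1}$, and a group isomorphism $\phi: G\to \varinjlim (A_n:\mathbf Z^{f(n)}\to\mathbf Z^{f(n+1)})$ that carries the positive cone of $G$ onto the cone of the direct limit ordering (the set of classes $[v,n]$ with $v\ge 0$ coordinatewise) and satisfies $\phi(H)=\bigcup_n[\mathbf 1_{f(n)},n]\mathbf Z$, where $\mathbf 1_{f(n)}$ is the column of ones. It is \emph{of size $s$} if $f(n)=s$ for all $n$. For a group homomorphism $t: J\to M$ of abelian groups, the extension $0\to\ker t\to J\to t(J)\to 0$ is \emph{nearly split} if there is a subgroup $H_0$ of $J$ with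 $H_0\cap\ker t=0$ such that $\ker t\oplus H_0$ has finite index in $J$. \textbf{Theorem.} Let $G$ be a countable simple dimension group with unique trace $\tau$, and let $H$ be a noncyclic rank-one subgroup of $G$ such that $\tau(H)\neq 0$ and $G/H$ is torsion-free. (a) If $\operatorname{rank} G=k+1$ with $k\ge 0$ an integer, then there exists an ERS realization of $G$ with respect to $H$ of size $k+2$; if moreover $G/H$ is free, then the extension $0\to\ker\tau\to G\to\tau(G)\to 0$ is nearly split. (b) Without any restriction on the rank of $G$, there exists an ERS realization of $G$ with respect to $H$. -/

import Mathlib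

namespace ERS

/-- Dimension group: a directed, unperforated partially ordered abelian group with the
Riesz interpolation property. -/
structure IsDimensionGroup (G : Type*) [AddCommGroup G] [PartialOrder G]
    [IsOrderedAddMonoid G] : Prop where
  directed : ∀ a b : G, ∃ c, a ≤ c ∧ b ≤ c
  unperforated : ∀ (n : ℕ) (g : G), 0 < n → 0 ≤ n • g → 0 ≤ g
  interpolation : ∀ a₁ a₂ b₁ b₂ : G, a₁ ≤ b₁ → a₁ ≤ b₂ → a₂ ≤ b₁ → a₂ ≤ b₂ →
    ∃ c, a₁ ≤ c ∧ a₂ ≤ c ∧ c ≤ b₁ ∧ c ≤ b₂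

/-- Order ideal: a convex directed subgroup. -/
structure IsOrderIdeal {G : Type*} [AddCommGroup G] [PartialOrder G]
    (I : AddSubgroup G) : Prop where
  convex : ∀ a b : G, 0 ≤ a → a ≤ b → b ∈ I → a ∈ I
  directed : ∀ x ∈ I, ∃ y ∈ I, ∃ z ∈ I, 0 ≤ y ∧ 0 ≤ z ∧ x = y - z

/-- A simple dimension group: nonzero, and without order ideals other than `0` and `G`. -/
structure IsSimpleDimensionGroup (G : Type*) [AddCommGroup G] [PartialOrder G]
    [IsOrderedAddMonoid G] : Prop extends IsDimensionGroup G where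
  nontrivial : Nontrivial G
  simple : ∀ I : AddSubgroup G, IsOrderIdeal I → I = ⊥ ∨ I = ⊤

/-- A trace: a nonzero positive group homomorphism to the reals. -/
structure IsTrace {G : Type*} [AddCommGroup G] [PartialOrder G] (τ : G →+ ℝ) : Prop where
  nonneg : ∀ g : G, 0 ≤ g → 0 ≤ τ g
  ne_zero : τ ≠ 0

/-- `τ` is the unique trace of `G`, up to the usual positive scalar multiple. -/
structure IsUniqueTrace {G : Type*} [AddCommGroup G] [PartialOrder G] (τ : G →+ ℝ) : Prop where
  isTrace : IsTrace τ
  unique : ∀ σ : G →+ ℝ, IsTrace σ → ∃ c : ℝ, 0 < c ∧ ∀ g, σ g = c * τ g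

section Limit

variable {f : ℕ → ℕ} (A : ∀ n, Matrix (Fin (f (n + 1))) (Fin (f n)) ℤ)

/-- The composite `A (n-1) ∘ ⋯ ∘ A m : ℤ^{f m} → ℤ^{f n}`. -/
def transition (m n : ℕ) (h : m ≤ n) : (Fin (f m) → ℤ) →+ (Fin (f n) → ℤ) :=
  Nat.leRecOn (C := fun j => (Fin (f m) → ℤ) →+ (Fin (f j) → ℤ)) h
    (fun {j} g => (A j).mulVecLin.toAddMonoidHom.comp g) (AddMonoidHom.id _)

/-- The direct limit group `lim A n : ℤ^{f n} → ℤ^{f (n+1)}`. -/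
abbrev MatrixLimit : Type :=
  AddCommGroup.DirectLimit (fun n => Fin (f n) → ℤ) (transition A)

/-- The class `[v, n]` in the direct limit. -/
noncomputable abbrev limitClass (n : ℕ) : (Fin (f n) → ℤ) →+ MatrixLimit A :=
  AddCommGroup.DirectLimit.of (fun n => Fin (f n) → ℤ) (transition A) n

/-- The positive cone of the direct limit ordering. -/
def limitCone : Set (MatrixLimit A) :=
  {x | ∃ (n : ℕ) (v : Fin (f n) → ℤ), (∀ i, 0 ≤ v i) ∧ x = limitClass A n v}

end Limit

/-- An equal row sum realization of `G` with respect to the subgroup `H`. -/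
structure ERSRealization (G : Type*) [AddCommGroup G] [PartialOrder G]
    (H : AddSubgroup G) where
  /-- matrix sizes -/
  size : ℕ → ℕ
  size_pos : ∀ n, 0 < size n
  /-- the transition matrices -/
  mat : ∀ n, Matrix (Fin (size (n + 1))) (Fin (size n)) ℤ
  mat_nonneg : ∀ n i j, 0 ≤ mat n i j
  /-- the common row sum of each matrix -/
  rowSum : ℕ → ℤ
  rowSum_pos : ∀ n, 0 < rowSum n
  sum_row : ∀ n i, ∑ j, mat n i j = rowSum n
  /-- the group isomorphism with the limit -/
  iso : G ≃+ MatrixLimit mat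
  /-- the isomorphism identifies the positive cones -/
  iso_order : ∀ g : G, 0 ≤ g ↔ iso g ∈ limitCone mat
  /-- `H` is carried onto `⋃ n, [1, n] ℤ` -/
  iso_image : iso '' (H : Set G) = ⋃ n, {x | ∃ z : ℤ, x = z • limitClass mat n (fun _ => 1)}

/-- The extension `0 → ker t → J → t(J) → 0` is nearly split: some subgroup of finite index in `J`
is an internal direct sum `ker t ⊕ H₀`. -/
def NearlySplit {J M : Type*} [AddCommGroup J] [AddCommGroup M] (t : J →+ M) : Prop :=
  ∃ J₀ H₀ : AddSubgroup J, Disjoint t.ker H₀ ∧ t.ker ⊔ H₀ = J₀ ∧ J₀.FiniteIndex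

end ERS

/-! Uniqueness of the trace forces `0 < g ↔ 0 < τ g` (`IsSimpleDimensionGroup.pos_iff`): otherwise a
total cone containing the positive cone and `-g` would carry a trace not proportional to `τ`. From
then on only `τ` matters.

The heart is `exists_factorization`. A finitely generated `M` is the sum of `M ∩ H` and the span of
lifts `l j` of a basis of its image in `G ⧸ H`, which is free, being finitely generated and
torsion-free. Let `k` be its rank. As `H` is noncyclic of rank one, there is `u ∈ H` of tiny
positive trace with `u = N • h`. On the circle of length `τ u`, place `0`, `h` and the `l j`, each
moved by a small multiple of `h` to keep all points distinct. These `k + 2` points cut `u` into `k +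
2` positive arcs that generate the `l j`. All coordinates of `l j` lie within `k + 3` of `τ (l j) /
τ u`, so finitely many elements of positive trace get nonnegative coordinates once `τ u` is small,
while elements of `M ∩ H` become multiples of the all-ones vector, which stands for `u`.

Iterating along an exhaustion of `G`, the maps `ψ (n + 1) ∘ φ n` are the matrices; they send ones to
a multiple of ones, whence equal row sums. Starting from a subgroup whose image in `G ⧸ H` has full
rank fixes the size. For near splitting, `τ` is injective on `H`, and `H` is enlarged by a
complement of the purification of `H + ker τ`. -/

namespace ERS

/-! ### Total cones and the real-valued homomorphisms they define. -/

section Cone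

variable {G : Type*} [AddCommGroup G]

/-- A submonoid avoiding `-u` but containing `u` extends to a total one avoiding `-u`. -/
theorem exists_total_submonoid (C : AddSubmonoid G) (u : G) (hu : u ∈ C) (hnu : -u ∉ C) :
    ∃ P : AddSubmonoid G, C ≤ P ∧ -u ∉ P ∧ ∀ x, x ∈ P ∨ -x ∈ P := by
  obtain ⟨P, hCP, hP⟩ := zorn_le_nonempty₀ {P : AddSubmonoid G | -u ∉ P} (by
    intro c hc hchain y hy
    refine ⟨sSup c, ?_, fun z hz => le_sSup hz⟩
    intro hmem
    obtain ⟨z, hz, hz'⟩ :=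
      (AddSubmonoid.mem_sSup_of_directedOn ⟨y, hy⟩ hchain.directedOn).1 hmem
    exact hc hz hz') C hnu
  have hPu : -u ∉ P := hP.prop
  have huP : u ∈ P := hCP hu
  have key : ∀ x, x ∉ P → ∃ p ∈ P, ∃ n : ℕ, p + n • x = -u := by
    intro x hx
    by_contra hcon
    have hle : P ⊔ AddSubmonoid.multiples x ≤ P := hP.le_of_ge (y := P ⊔ AddSubmonoid.multiples x)
      (fun hmem => hcon (by
        obtain ⟨p, hp, q, ⟨n, hn⟩, hpq⟩ := AddSubmonoid.mem_sup.1 hmem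
        refine ⟨p, hp, n, ?_⟩
        rw [← hpq, ← hn])) le_sup_left
    exact hx (hle (AddSubmonoid.mem_sup_right (AddSubmonoid.mem_multiples x)))
  refine ⟨P, hCP, hPu, fun x => ?_⟩
  by_contra! h
  obtain ⟨p, hp, n, hn⟩ := key x h.1
  obtain ⟨q, hq, m, hm⟩ := key (-x) h.2
  have hn0 : n ≠ 0 := by
    rintro rfl
    exact hPu (by rw [← hn]; simpa using hp)
  obtain ⟨n, rfl⟩ := Nat.exists_eq_succ_of_ne_zero hn0
  apply hPu
  -- Adding `m` times `hn` to `n + 1` times `hm` cancels `x` and leaves `-(m + n + 1) • u`.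
  have h1 : -u = (m • p + (n + 1) • q) + (m + n) • u := by
    have e1 : m • p = m • (-u) - (m * (n + 1)) • x := by
      rw [← hn, smul_add, mul_smul]; simp
    have e2 : (n + 1) • q = (n + 1) • (-u) + (m * (n + 1)) • x := by
      rw [← hm, smul_add, mul_comm, mul_smul]; simp
    rw [e1, e2]
    module
  rw [h1]
  exact P.add_mem (P.add_mem (P.nsmul_mem hp _) (P.nsmul_mem hq _)) (P.nsmul_mem huP _)

/-- A total submonoid with an order unit `u` carries a normalized positive homomorphism to `ℝ`. -/
theorem exists_hom_of_total_submonoid (P : AddSubmonoid G) (u : G) (hu : u ∈ P) (hnu : -u ∉ P)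
    (htot : ∀ x, x ∈ P ∨ -x ∈ P) (hunit : ∀ x, ∃ n : ℕ, n • u - x ∈ P) :
    ∃ σ : G →+ ℝ, (∀ x ∈ P, 0 ≤ σ x) ∧ σ u = 1 := by
  have hz : ∀ k : ℤ, k • u ∈ P → 0 ≤ k := by
    intro k hk
    by_contra! hneg
    obtain ⟨j, hj⟩ : ∃ j : ℕ, k = -(j + 1) := ⟨(-k - 1).toNat, by omega⟩
    apply hnu
    have : -u = k • u + j • u := by rw [hj]; module
    rw [this]
    exact P.add_mem hk (P.nsmul_mem hu _)
  -- The rational upper bounds of `x` measured in units of `u`; their infimum will be the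
  -- homomorphism.
  let S : G → Set ℝ := fun x =>
    {r | ∃ (m : ℤ) (n : ℕ), 0 < n ∧ m • u - n • x ∈ P ∧ r = (m : ℝ) / n}
  let s : G → ℝ := fun x => sInf (S x)
  have hne : ∀ x, (S x).Nonempty := by
    intro x
    obtain ⟨n, hn⟩ := hunit x
    exact ⟨_, n, 1, one_pos, by simpa using hn, rfl⟩
  have hlow : ∀ x (N : ℤ), N • u + x ∈ P → ∀ r ∈ S x, -(N : ℝ) ≤ r := by
    rintro x N hN r ⟨m, n, hn, hmn, rfl⟩
    have h1 : (m + n * N) • u ∈ P := by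
      have : (m + n * N) • u = (m • u - n • x) + n • (N • u + x) := by module
      rw [this]
      exact P.add_mem hmn (P.nsmul_mem hN _)
    have h2 : (0 : ℝ) ≤ m + n * N := by exact_mod_cast hz _ h1
    have hn' : (0 : ℝ) < n := by exact_mod_cast hn
    rw [le_div_iff₀ hn']
    linarith
  have hbdd : ∀ x, BddBelow (S x) := by
    intro x
    obtain ⟨N, hN⟩ := hunit (-x)
    exact ⟨_, fun r hr => hlow x N (by simpa using hN) r hr⟩
  have hsub : ∀ x y, s (x + y) ≤ s x + s y := by
    intro x y
    have : ∀ a ∈ S x, ∀ b ∈ S y, s (x + y) ≤ a + b := by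
      rintro a ⟨m, n, hn, hmn, rfl⟩ b ⟨m', n', hn', hmn', rfl⟩
      refine csInf_le (hbdd _) ⟨m * n' + m' * n, n * n', by positivity, ?_, ?_⟩
      · have : (m * n' + m' * n) • u - (n * n') • (x + y)
            = n' • (m • u - n • x) + n • (m' • u - n' • y) := by module
        rw [this]
        exact P.add_mem (P.nsmul_mem hmn _) (P.nsmul_mem hmn' _)
      · have : (n : ℝ) ≠ 0 := by positivity
        have : (n' : ℝ) ≠ 0 := by positivity
        push_cast
        field_simp
    have h1 : ∀ a ∈ S x, s (x + y) - a ≤ s y := fun a ha =>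
      le_csInf (hne y) fun b hb => by linarith [this a ha b hb]
    have h2 : s (x + y) - s y ≤ s x := le_csInf (hne x) fun a ha => by linarith [h1 a ha]
    linarith
  have hnn : ∀ x ∈ P, 0 ≤ s x := fun x hx =>
    le_csInf (hne x) fun r hr => by simpa using hlow x 0 (by simpa using hx) r hr
  -- Otherwise rationals `a < s x` and `b < s (-x)` with `a + b > 0` would, by totality, put a
  -- negative multiple of `u` in `P`.
  have hneg : ∀ x, s x + s (-x) ≤ 0 := by
    intro x
    by_contra! h
    obtain ⟨a, ha1, ha2⟩ := exists_rat_btwn (show -s (-x) < s x by linarith)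
    obtain ⟨b, hb1, hb2⟩ := exists_rat_btwn (show -(a : ℝ) < s (-x) by linarith)
    have hcut : ∀ (q : ℚ) (y : G), (q : ℝ) < s y → q.den • y - q.num • u ∈ P := by
      intro q y hq
      rcases htot (q.num • u - q.den • y) with h | h
      · refine absurd (csInf_le (hbdd y) ⟨q.num, q.den, q.pos, h, ?_⟩) (not_le.2 hq)
        exact_mod_cast (Rat.num_div_den q).symm
      · simpa using h
    have h1 := hcut a x ha2
    have h2 := hcut b (-x) hb2
    have h3 : (-(b.den * a.num + a.den * b.num) : ℤ) • u ∈ P := by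
      have : (-(b.den * a.num + a.den * b.num) : ℤ) • u
          = b.den • (a.den • x - a.num • u) + a.den • (b.den • (-x) - b.num • u) := by module
      rw [this]
      exact P.add_mem (P.nsmul_mem h1 _) (P.nsmul_mem h2 _)
    have h4 := hz _ h3
    have h5 : (0 : ℝ) < a + b := by linarith
    have h6 : (0 : ℚ) < a + b := by exact_mod_cast h5
    have pa : (0 : ℚ) < a.den := by exact_mod_cast a.pos
    have pb : (0 : ℚ) < b.den := by exact_mod_cast b.pos
    have h7 : (0 : ℚ) < b.den * a.num + a.den * b.num := by
      have : (b.den * a.num + a.den * b.num : ℚ) = a.den * b.den * (a + b) := by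
        rw [← Rat.den_mul_eq_num a, ← Rat.den_mul_eq_num b]
        ring
      rw [this]
      positivity
    have h8 : (0 : ℤ) < b.den * a.num + a.den * b.num := by exact_mod_cast h7
    omega
  have h0 : s 0 = 0 := by
    have h1 := hneg 0
    have h2 := hnn 0 P.zero_mem
    simp only [neg_zero] at h1
    linarith
  have hodd : ∀ x, s (-x) = -s x := by
    intro x
    have h1 := hsub x (-x)
    rw [add_neg_cancel, h0] at h1
    linarith [hneg x]
  refine ⟨AddMonoidHom.mk' s fun x y => le_antisymm (hsub x y) ?_, hnn, ?_⟩
  · have := hsub (-x) (-y)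
    rw [← neg_add, hodd, hodd, hodd] at this
    linarith
  · change s u = 1
    refine le_antisymm (csInf_le (hbdd u) ⟨1, 1, one_pos, by simp, by simp⟩) ?_
    refine le_csInf (hne u) ?_
    have := hlow u (-1) (by simp)
    simpa using this

end Cone

/-! ### The trace determines the order. -/

section Order

variable {G : Type*} [AddCommGroup G] [PartialOrder G] [IsOrderedAddMonoid G]

/-- A nonzero positive element of a simple dimension group is an order unit. -/
theorem IsSimpleDimensionGroup.exists_nsmul_ge (hG : IsSimpleDimensionGroup G) {u : G}
    (hu : 0 < u) (x : G) : ∃ n : ℕ, x ≤ n • u := by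
  -- The order ideal generated by `u`; simplicity makes it everything.
  let I : AddSubgroup G :=
    { carrier := {x | ∃ n : ℕ, x ≤ n • u ∧ -x ≤ n • u}
      zero_mem' := ⟨0, by simp⟩
      add_mem' := by
        rintro a b ⟨n, h1, h2⟩ ⟨m, h3, h4⟩
        refine ⟨n + m, ?_, ?_⟩
        · rw [add_smul]; exact add_le_add h1 h3
        · rw [add_smul, neg_add]; exact add_le_add h2 h4
      neg_mem' := by
        rintro a ⟨n, h1, h2⟩
        exact ⟨n, h2, by simpa using h1⟩ }
  have huI : u ∈ I := ⟨1, by simp, by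
    rw [one_smul]; exact (neg_nonpos.2 hu.le).trans hu.le⟩
  have hI : IsOrderIdeal I := by
    constructor
    · rintro a b ha hab ⟨n, h1, -⟩
      exact ⟨n, hab.trans h1, (neg_nonpos.2 ha).trans (ha.trans (hab.trans h1))⟩
    · rintro x ⟨n, h1, h2⟩
      have hn : n • u ∈ I := I.nsmul_mem huI n
      refine ⟨x + n • u, I.add_mem ⟨n, h1, h2⟩ hn, n • u, hn, ?_, nsmul_nonneg hu.le n, by simp⟩
      exact neg_le_iff_add_nonneg'.1 h2
  rcases hG.simple I hI with h | h
  · rw [h, AddSubgroup.mem_bot] at huI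
    exact absurd huI hu.ne'
  · have : x ∈ I := h ▸ AddSubgroup.mem_top x
    obtain ⟨n, hn, -⟩ := this
    exact ⟨n, hn⟩

/-- As `g` is an order unit, `τ g = 0` would bound `τ` above by `0` on the whole group, forcing `τ =
0`. -/
theorem IsSimpleDimensionGroup.trace_pos (hG : IsSimpleDimensionGroup G) {τ : G →+ ℝ}
    (hτ : IsTrace τ) {g : G} (hg : 0 < g) : 0 < τ g := by
  refine lt_of_le_of_ne (hτ.nonneg g hg.le) fun h0 => hτ.ne_zero ?_
  have hle : ∀ x, τ x ≤ 0 := by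
    intro x
    obtain ⟨n, hn⟩ := hG.exists_nsmul_ge hg x
    have := hτ.nonneg _ (sub_nonneg.2 hn)
    rw [map_sub, map_nsmul, ← h0] at this
    simpa using this
  ext x
  refine le_antisymm (hle x) ?_
  simpa using hle (-x)

/-- In a simple dimension group with a unique trace, the trace determines the order. -/
theorem IsSimpleDimensionGroup.pos_iff (hG : IsSimpleDimensionGroup G) {τ : G →+ ℝ}
    (hτ : IsUniqueTrace τ) (g : G) : 0 < g ↔ 0 < τ g := by
  refine ⟨hG.trace_pos hτ.isTrace, fun hg => ?_⟩
  suffices h : 0 ≤ g from lt_of_le_of_ne h (by rintro rfl; simp at hg)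
  by_contra hng
  obtain ⟨u, hu⟩ : ∃ u : G, 0 < u := by
    obtain ⟨c, hc0, hcg⟩ := hG.directed 0 g
    rcases hc0.eq_or_lt with rfl | h
    · refine ⟨-g, lt_of_le_of_ne (by simpa using hcg) ?_⟩
      intro h
      exact hng (by rw [eq_comm, neg_eq_zero] at h; rw [h])
    · exact ⟨c, h⟩
  -- The positive cone enlarged by `-g`. Unperforation keeps `-u` out: `u ≤ n • g` with `n > 0`
  -- would give `0 ≤ g`.
  let C : AddSubmonoid G :=
    { carrier := {x | ∃ n : ℕ, 0 ≤ x + n • g}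
      zero_mem' := ⟨0, by simp⟩
      add_mem' := by
        rintro a b ⟨n, hn⟩ ⟨m, hm⟩
        refine ⟨n + m, (add_nonneg hn hm).trans_eq (by module)⟩ }
  have hpos : ∀ x : G, 0 ≤ x → x ∈ C := fun x hx => ⟨0, by simpa using hx⟩
  have hnu : -u ∉ C := by
    rintro ⟨n, hn⟩
    rcases Nat.eq_zero_or_pos n with rfl | hn0
    · simp only [zero_smul, add_zero, Left.nonneg_neg_iff] at hn
      exact hu.not_ge hn
    · refine hng (hG.unperforated n g hn0 (hu.le.trans ?_))
      simpa [neg_add_eq_sub] using hn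
  obtain ⟨P, hCP, hPu, htot⟩ := exists_total_submonoid C u (hpos u hu.le) hnu
  obtain ⟨σ, hσ, hσu⟩ := exists_hom_of_total_submonoid P u (hCP (hpos u hu.le)) hPu htot
    (fun x => by
      obtain ⟨n, hn⟩ := hG.exists_nsmul_ge hu x
      exact ⟨n, hCP (hpos _ (sub_nonneg.2 hn))⟩)
  obtain ⟨c, hc, h⟩ := hτ.unique σ ⟨fun x hx => hσ x (hCP (hpos x hx)), by
    rintro rfl; simp at hσu⟩
  have h1 : 0 ≤ σ (-g) := hσ _ (hCP ⟨1, by simp⟩)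
  rw [map_neg, h] at h1
  have := mul_pos hc hg
  linarith

end Order

/-! ### Cutting a circle into arcs. -/

section Circle

/-- Translating each of `k` reals by a small multiple of `1 / N` makes them distinct modulo `1`,
also from `0` and `1 / N`. -/
theorem exists_shift_fract_injective {k N : ℕ} (hN : k + 2 ≤ N) (t : Fin k → ℝ) :
    ∃ c : Fin k → ℕ, (∀ j, c j < k + 2) ∧
      Function.Injective (fun j => Int.fract (t j + c j / N)) ∧
      ∀ j, Int.fract (t j + c j / N) ≠ 0 ∧ Int.fract (t j + c j / N) ≠ 1 / N := by
  classical
  have hN0 : (0 : ℝ) < N := by exact_mod_cast (by omega : 0 < N)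
  -- Of `k + 2` distinct shifts at most two are forbidden, so each of the `k` indices keeps at least
  -- `k` choices and Hall's condition is immediate.
  let T : Fin k → Finset ℝ := fun j =>
    ((Finset.range (k + 2)).image fun c : ℕ => Int.fract (t j + c / N)) \ {0, 1 / (N : ℝ)}
  have hT : ∀ j, k ≤ (T j).card := by
    intro j
    have h1 : ((Finset.range (k + 2)).image fun c : ℕ => Int.fract (t j + c / N)).card
        = k + 2 := by
      rw [Finset.card_image_of_injOn, Finset.card_range]
      intro a ha b hb hab
      obtain ⟨z, hz⟩ := Int.fract_eq_fract.1 hab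
      have ha' : a < N := by simp at ha; omega
      have hb' : b < N := by simp at hb; omega
      have h2 : ((a : ℤ) : ℝ) - b = z * N := by
        field_simp at hz
        push_cast
        linarith
      have h3 : (a : ℤ) - b = z * N := by exact_mod_cast h2
      have h4 : z = 0 := by
        by_contra hz0
        rcases lt_or_gt_of_ne hz0 with h | h
        · nlinarith
        · nlinarith
      rw [h4] at h3
      omega
    have h2 := Finset.le_card_sdiff ({0, 1 / (N : ℝ)} : Finset ℝ)
      ((Finset.range (k + 2)).image fun c : ℕ => Int.fract (t j + c / N))
    have h3 := Finset.card_le_two (a := (0 : ℝ)) (b := 1 / (N : ℝ))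
    change k ≤ (_ \ _ : Finset ℝ).card
    omega
  obtain ⟨f, hf, hfT⟩ := (Finset.all_card_le_biUnion_card_iff_exists_injective T).1 (by
    intro s
    rcases s.eq_empty_or_nonempty with rfl | ⟨j, hj⟩
    · simp
    · calc s.card ≤ k := by simpa using s.card_le_univ
        _ ≤ (T j).card := hT j
        _ ≤ _ := Finset.card_le_card (Finset.subset_biUnion_of_mem T hj))
  have h : ∀ j, ∃ c : ℕ, c < k + 2 ∧ Int.fract (t j + c / N) = f j := by
    intro j
    have := (Finset.mem_sdiff.1 (hfT j)).1
    simpa using this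
  choose c hc hcf using h
  refine ⟨c, hc, ?_, fun j => ?_⟩
  · simpa only [hcf] using hf
  · have := (Finset.mem_sdiff.1 (hfT j)).2
    rw [hcf]
    simpa using this

variable {G : Type*} [AddCommGroup G]

/-- Points of `G` that are distinct modulo `u` cut the circle `ℝ / τ u` into positive arcs
with sum `u`, and every point is a sum of arcs modulo `u`. -/
theorem exists_arcs (τ : G →+ ℝ) {u : G} (hu : 0 < τ u) {s : ℕ} (y : Fin (s + 1) → G)
    (h0 : y 0 = 0) (hy : Function.Injective fun i => Int.fract (τ (y i) / τ u)) :
    ∃ (φ : (Fin (s + 1) → ℤ) →+ G) (w : Fin (s + 1) → Fin (s + 1) → ℤ),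
      (∀ i, 0 < τ (φ (Pi.single i 1))) ∧ φ (fun _ => 1) = u ∧ (∀ j, φ (w j) = y j) ∧
      ∀ j i, |(w j i : ℝ) - τ (y j) / τ u| ≤ 1 := by
  classical
  set r : Fin (s + 1) → ℝ := fun i => Int.fract (τ (y i) / τ u) with hr
  let e := Tuple.sort r
  have hmono : StrictMono (r ∘ e) :=
    (Tuple.monotone_sort r).strictMono_of_injective (hy.comp e.injective)
  have he0 : e 0 = 0 := by
    obtain ⟨i, hi⟩ := e.surjective 0
    by_contra hne
    have hi0 : 0 < i := by
      rw [Fin.pos_iff_ne_zero]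
      rintro rfl
      exact hne hi
    have h1 := hmono hi0
    have h2 : r 0 = 0 := by simp [hr, h0]
    simp only [Function.comp_apply, hi, h2] at h1
    exact absurd h1 (not_lt.2 (Int.fract_nonneg _))
  let z : Fin (s + 1) → G := fun i => y i - ⌊τ (y i) / τ u⌋ • u
  have hz : ∀ i, τ (z i) = r i * τ u := by
    intro i
    simp only [z, hr, map_sub, map_zsmul, Int.fract, zsmul_eq_mul]
    field_simp
  -- The reduced points in circular order, closed up by `u`; the arcs are the consecutive
  -- differences, so their sums telescope.
  let Z : ℕ → G := fun i => if h : i < s + 1 then z (e ⟨i, h⟩) else u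
  have hZ0 : Z 0 = 0 := by
    have : Z 0 = z (e 0) := dif_pos (Nat.succ_pos s)
    simp [this, he0, z, h0]
  have hZu : Z (s + 1) = u := by simp [Z]
  have hZz : ∀ i : Fin (s + 1), Z i = z (e i) := fun i => dif_pos i.is_lt
  have hZlt : ∀ i : Fin (s + 1), τ (Z i) < τ (Z (i + 1)) := by
    intro i
    rw [hZz, hz]
    by_cases h : (i : ℕ) + 1 < s + 1
    · have h2 : Z (i + 1) = z (e ⟨i + 1, h⟩) := by simp only [Z, h, dif_pos]
      rw [h2, hz]
      refine mul_lt_mul_of_pos_right (hmono ?_) hu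
      exact Fin.lt_def.2 (Nat.lt_succ_self _)
    · have h2 : Z (i + 1) = u := by simp only [Z, h, dif_neg, not_false_iff]
      rw [h2]
      exact (mul_lt_iff_lt_one_left hu).2 (Int.fract_lt_one _)
  let φ : (Fin (s + 1) → ℤ) →+ G := AddMonoidHom.mk'
    (fun v => ∑ i : Fin (s + 1), v i • (Z (i + 1) - Z i)) (by
      intro a b
      simp [add_smul, Finset.sum_add_distrib])
  have hφ : ∀ v, φ v = ∑ i : Fin (s + 1), v i • (Z (i + 1) - Z i) := fun v => rfl
  have hφ1 : φ (fun _ => 1) = u := by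
    rw [hφ]
    simp only [one_smul]
    rw [Fin.sum_univ_eq_sum_range (fun i => Z (i + 1) - Z i), Finset.sum_range_sub, hZ0, hZu,
      sub_zero]
  have hφlt : ∀ m : ℕ, m ≤ s + 1 → φ (fun i => if (i : ℕ) < m then 1 else 0) = Z m := by
    intro m hm
    rw [hφ, Fin.sum_univ_eq_sum_range
      (fun i => (if i < m then (1 : ℤ) else 0) • (Z (i + 1) - Z i))]
    simp only [ite_smul, one_smul, zero_smul]
    rw [← Finset.sum_filter]
    have : (Finset.range (s + 1)).filter (fun i => i < m) = Finset.range m := by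
      ext i; simp; omega
    rw [this, Finset.sum_range_sub, hZ0, sub_zero]
  -- Full turns around the circle plus the initial arcs leading to `y j`: each coordinate is the
  -- floor or one more.
  refine ⟨φ, fun j => ⌊τ (y j) / τ u⌋ • (fun _ : Fin (s + 1) => (1 : ℤ)) +
    fun i : Fin (s + 1) => if (i : ℕ) < (e.symm j : ℕ) then (1 : ℤ) else 0, ?_, hφ1, ?_, ?_⟩
  · intro i
    rw [hφ, Finset.sum_eq_single i (by
      intro b _ hb
      simp [hb]) (by simp)]
    simp only [Pi.single_eq_same, one_smul, map_sub, sub_pos]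
    exact hZlt i
  · intro j
    rw [map_add, map_zsmul, hφ1, hφlt _ (e.symm j).is_lt.le]
    rw [hZz]
    simp [z]
  · intro j i
    have h1 := Int.floor_le (τ (y j) / τ u)
    have h2 := Int.lt_floor_add_one (τ (y j) / τ u)
    simp only [Pi.add_apply, Pi.smul_apply, smul_eq_mul, mul_one, Int.cast_add]
    rw [abs_le]
    split_ifs <;> constructor <;> push_cast <;> linarith

/-- Given `u = N • h` with `N` large, `u` is a sum of `k + 2` positive elements that generate
the given elements `l j`, each with coefficients close to `τ (l j) / τ u`. -/
theorem exists_balanced_generators (τ : G →+ ℝ) {u h : G} (hu : 0 < τ u) {k N : ℕ}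
    (hN : k + 2 ≤ N) (huh : u = N • h) (l : Fin k → G) :
    ∃ (φ : (Fin (k + 2) → ℤ) →+ G) (w : Fin k → Fin (k + 2) → ℤ),
      (∀ i, 0 < τ (φ (Pi.single i 1))) ∧ φ (fun _ => 1) = u ∧ (∀ j, φ (w j) = l j) ∧
      ∀ j i, |(w j i : ℝ) - τ (l j) / τ u| ≤ k + 3 := by
  have hN0 : (0 : ℝ) < N := by exact_mod_cast (by omega : 0 < N)
  have hN1 : (1 : ℝ) < N := by exact_mod_cast (by omega : 1 < N)
  have hτh : τ h / τ u = 1 / N := by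
    have : τ u = N * τ h := by rw [huh]; simp
    rw [this] at hu ⊢
    have : τ h ≠ 0 := by rintro h0; simp [h0] at hu
    field_simp
  obtain ⟨c, hc, hinj, hav⟩ := exists_shift_fract_injective hN fun j => τ (l j) / τ u
  have hx : ∀ j, τ (l j + c j • h) / τ u = τ (l j) / τ u + c j / N := by
    intro j
    rw [map_add, map_nsmul, add_div, nsmul_eq_mul, mul_div_assoc, hτh]
    ring
  have hfN : Int.fract (1 / (N : ℝ)) = 1 / N :=
    Int.fract_eq_self.2 ⟨by positivity, by rw [div_lt_one hN0]; exact hN1⟩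
  -- Having `h` itself among the points lets the shift `c j • h` be undone in coordinates, at the
  -- cost of an error of at most `c j`.
  let y : Fin (k + 2) → G := Fin.cons 0 (Fin.cons h fun j => l j + c j • h)
  obtain ⟨φ, w, hφ, hφ1, hw, hwb⟩ := exists_arcs τ hu y rfl (by
    have : (fun i => Int.fract (τ (y i) / τ u)) = Fin.cons 0 (Fin.cons (1 / (N : ℝ))
        fun j => Int.fract (τ (l j) / τ u + c j / N)) := by
      funext i
      refine Fin.cases ?_ (fun i => ?_) i
      · simp [y]
      · refine Fin.cases ?_ (fun j => ?_) i
        · simp only [y, Fin.cons_succ, Fin.cons_zero]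
          rw [hτh, hfN]
        · simp only [y, Fin.cons_succ]
          rw [hx]
    rw [this, Fin.cons_injective_iff, Fin.cons_injective_iff]
    refine ⟨?_, ?_, hinj⟩
    · rintro ⟨i, hi⟩
      revert hi
      refine Fin.cases ?_ (fun j => ?_) i
      · simp only [Fin.cons_zero]
        intro h
        have : 0 < 1 / (N : ℝ) := by positivity
        linarith
      · simp only [Fin.cons_succ]
        exact (hav j).1
    · rintro ⟨j, hj⟩
      exact (hav j).2 hj)
  refine ⟨φ, fun j => w j.succ.succ - c j • w 1, hφ, hφ1, fun j => ?_, fun j i => ?_⟩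
  · rw [map_sub, map_nsmul, hw, hw]
    have h1 : y 1 = h := rfl
    have h2 : y j.succ.succ = l j + c j • h := rfl
    rw [h1, h2]
    simp
  · have h1 := hwb j.succ.succ i
    have h2 := hwb 1 i
    have e1 : y 1 = h := rfl
    have e2 : y j.succ.succ = l j + c j • h := rfl
    rw [e2, hx] at h1
    rw [e1, hτh] at h2
    have hcj : (c j : ℝ) ≤ k + 2 := by exact_mod_cast (hc j).le
    beta_reduce
    rw [Pi.sub_apply, Pi.smul_apply, nsmul_eq_mul, Int.cast_sub, Int.cast_mul,
      Int.cast_natCast]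
    have e3 : (w j.succ.succ i : ℝ) - c j * w 1 i - τ (l j) / τ u
        = (w j.succ.succ i - (τ (l j) / τ u + c j / N)) - c j * (w 1 i - 1 / N) := by ring
    rw [e3]
    calc _ ≤ |(w j.succ.succ i : ℝ) - (τ (l j) / τ u + c j / N)| + |c j * ((w 1 i : ℝ) - 1 / N)| :=
          abs_sub _ _
      _ ≤ 1 + c j * 1 := by
          rw [abs_mul, Nat.abs_cast]
          gcongr
      _ ≤ k + 3 := by linarith

end Circle

/-! ### Divisibility in noncyclic rank-one groups. -/

section RankOne

variable {G : Type*} [AddCommGroup G] {H : AddSubgroup G}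

/-- A homomorphism to `ℝ` that is nonzero on a torsion-free rank-one subgroup is injective there. -/
theorem eq_zero_of_map_eq_zero [IsAddTorsionFree G] (hrank : Module.rank ℤ H = 1) (τ : G →+ ℝ)
    (hτ : H.map τ ≠ ⊥) {x : G} (hx : x ∈ H) (h0 : τ x = 0) : x = 0 := by
  obtain ⟨y, hy, hy0⟩ : ∃ y ∈ H, τ y ≠ 0 := by
    by_contra! h
    refine hτ ((AddSubgroup.eq_bot_iff_forall _).2 ?_)
    rintro _ ⟨y, hy, rfl⟩
    exact h y hy
  by_contra hx0
  have hnli : ¬ LinearIndependent ℤ ![(⟨x, hx⟩ : H), ⟨y, hy⟩] := by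
    intro hli
    have := hli.cardinal_lift_le_rank
    rw [hrank] at this
    norm_num at this
  rw [LinearIndependent.pair_iff] at hnli
  push Not at hnli
  obtain ⟨a, b, hab, hne⟩ := hnli
  have hab' : a • x + b • y = 0 := by simpa using congrArg (Subtype.val) hab
  have hb : b = 0 := by
    have := congrArg τ hab'
    simpa [h0, hy0] using this
  subst hb
  simp only [zero_smul, add_zero, smul_eq_zero, hx0, or_false] at hab'
  exact hne hab' rfl

/-- Finitely generated subgroups of a rank-one torsion-free group are cyclic. -/
theorem exists_zmultiples_ge [IsAddTorsionFree G] (hrank : Module.rank ℤ H = 1)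
    (A : AddSubgroup G) (hA : A.FG) (hAH : A ≤ H) : ∃ u ∈ H, A ≤ AddSubgroup.zmultiples u := by
  let B : Submodule ℤ H := AddSubgroup.toIntSubmodule (A.addSubgroupOf H)
  have : AddGroup.FG (A.addSubgroupOf H) := by
    have : AddGroup.FG A := (AddGroup.fg_iff_addSubgroup_fg A).2 hA
    exact AddGroup.fg_of_surjective (f := (AddSubgroup.addSubgroupOfEquivOfLe hAH).symm.toAddMonoidHom)
      (AddSubgroup.addSubgroupOfEquivOfLe hAH).symm.surjective
  have : Module.Finite ℤ B := Module.Finite.iff_addGroup_fg.2 this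
  have : Module.Free ℤ B := Module.free_of_finite_type_torsion_free'
  have h1 : Module.rank ℤ B ≤ 1 := (Submodule.rank_le B).trans_eq hrank
  obtain ⟨v, hv⟩ := (rank_submodule_le_one_iff B).1 h1
  refine ⟨v, v.2, fun x hx => ?_⟩
  obtain ⟨n, hn⟩ := Submodule.mem_span_singleton.1 (hv.2 (show (⟨x, hAH hx⟩ : H) ∈ B from hx))
  exact ⟨n, by simpa using congrArg Subtype.val hn⟩

/-- Elements of a noncyclic rank-one group have arbitrarily large divisors. -/
theorem exists_eq_nsmul [IsAddTorsionFree G] (hrank : Module.rank ℤ H = 1)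
    (hcyc : ¬ IsAddCyclic H) {u : G} (hu : u ∈ H) (hu0 : u ≠ 0) (K : ℕ) :
    ∃ N : ℕ, K ≤ N ∧ ∃ v ∈ H, u = N • v := by
  induction K with
  | zero => exact ⟨1, by simp, u, hu, by simp⟩
  | succ K ih =>
    obtain ⟨N, hN, v, hv, rfl⟩ := ih
    obtain ⟨x, hx, hxv⟩ : ∃ x ∈ H, x ∉ AddSubgroup.zmultiples v := by
      by_contra! h
      refine hcyc ⟨⟨v, hv⟩, fun x => ?_⟩
      obtain ⟨n, hn⟩ := h x x.2
      exact ⟨n, Subtype.ext (by simpa using hn)⟩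
    obtain ⟨w, hw, hle⟩ := exists_zmultiples_ge hrank (AddSubgroup.closure {v, x})
      ((AddSubgroup.fg_iff _).2 ⟨{v, x}, rfl, by simp⟩) ((AddSubgroup.closure_le _).2 (by
        rintro y (rfl | rfl)
        exacts [hv, hx]))
    obtain ⟨n, hn⟩ := hle (AddSubgroup.subset_closure (Set.mem_insert v {x}))
    obtain ⟨m, hm⟩ := hle (AddSubgroup.subset_closure (Set.mem_insert_of_mem v rfl))
    have hn' : n • w = v := hn
    have hm' : m • w = x := hm
    -- If `n` were a unit, `x` would be a multiple of `v`. So passing to `w` at least doubles the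
    -- divisor.
    have hn2 : 2 ≤ n.natAbs := by
      by_contra! h
      have : n = 0 ∨ n = 1 ∨ n = -1 := by omega
      rcases this with rfl | rfl | rfl
      · exact hu0 (by simp [← hn'])
      · exact hxv ⟨m, by simp [← hn', hm']⟩
      · exact hxv ⟨-m, by simp [← hn', hm']⟩
    have hN0 : N ≠ 0 := by rintro rfl; simp at hu0
    refine ⟨N * n.natAbs, by nlinarith [Nat.pos_of_ne_zero hN0], n.sign • w, H.zsmul_mem hw _, ?_⟩
    rw [mul_smul, ← hn']
    congr 1
    rw [← natCast_zsmul, ← mul_smul, mul_comm, Int.sign_mul_natAbs]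

end RankOne

/-! ### Factoring a finitely generated subgroup through a free group. -/

section Step

variable {G : Type*} [AddCommGroup G] {H : AddSubgroup G}

/-- A finitely generated subgroup `M` of `G` factors through some `ℤ ^ (k + 2)` generated by
positive elements with sum in `H`, such that finitely many elements of positive trace get
nonnegative coordinates. -/
theorem exists_factorization [IsAddTorsionFree G] (τ : G →+ ℝ)
    (hrank : Module.rank ℤ H = 1) (hcyc : ¬ IsAddCyclic H)
    (hτ : H.map τ ≠ ⊥) (htf : IsAddTorsionFree (G ⧸ H)) (M : AddSubgroup G) (hM : M.FG)
    (S : Set G) (hSfin : S.Finite) (hS : ∀ x ∈ S, 0 < τ x) :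
    ∃ (φ : (Fin (Module.finrank ℤ (M.map (QuotientAddGroup.mk' H)) + 2) → ℤ) →+ G)
      (ψ : M →+ (Fin (Module.finrank ℤ (M.map (QuotientAddGroup.mk' H)) + 2) → ℤ)),
      (∀ i, 0 < τ (φ (Pi.single i 1))) ∧ φ (fun _ => 1) ∈ H ∧ (∀ x, φ (ψ x) = x) ∧
      (∀ x : M, (x : G) ∈ H → ∃ z : ℤ, ψ x = fun _ => z) ∧
      ∀ x : M, (x : G) ∈ S → ∀ i, 0 ≤ ψ x i := by
  classical
  set F := M.map (QuotientAddGroup.mk' H)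
  set k := Module.finrank ℤ F
  have hMfin : AddGroup.FG M := (AddGroup.fg_iff_addSubgroup_fg M).2 hM
  let q : M →+ F := (QuotientAddGroup.mk' H).addSubgroupMap M
  have hq : Function.Surjective q := AddMonoidHom.addSubgroupMap_surjective _ M
  have hFfg : AddGroup.FG F := AddGroup.fg_of_surjective hq
  have : Module.Finite ℤ F := Module.Finite.iff_addGroup_fg.2 hFfg
  have : Module.Free ℤ F := Module.free_of_finite_type_torsion_free'
  let b : Module.Basis (Fin k) ℤ F := Module.finBasis ℤ F
  have hl : ∀ j, ∃ l : M, q l = b j := fun j => hq (b j)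
  choose l hl using hl
  let β : M → Fin k → ℤ := fun x => b.repr (q x)
  have hβadd : ∀ x y, β (x + y) = β x + β y := by
    intro x y; funext j; simp [β]
  -- The projection of `M` onto `M ∩ H` along the span of the lifts.
  let η : M →+ G := AddMonoidHom.mk' (fun x => (x : G) - ∑ j, β x j • (l j : G)) (by
    intro x y
    simp only [hβadd, Pi.add_apply, add_smul, Finset.sum_add_distrib, AddSubgroup.coe_add]
    abel)
  have hη : ∀ x : M, (x : G) = η x + ∑ j, β x j • (l j : G) := by
    intro x
    simp [η]
  have hηH : ∀ x, η x ∈ H := by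
    intro x
    have h1 : q (x - ∑ j, β x j • l j) = 0 := by
      rw [map_sub, map_sum]
      simp only [map_zsmul, hl, β]
      rw [b.sum_repr, sub_self]
    have h2 : ((x - ∑ j, β x j • l j : M) : G) ∈ H := by
      have := congrArg Subtype.val h1
      exact (QuotientAddGroup.eq_zero_iff _).1 this
    simpa [η] using h2
  have hβH : ∀ x : M, (x : G) ∈ H → β x = 0 := by
    intro x hx
    have : q x = 0 := Subtype.ext ((QuotientAddGroup.eq_zero_iff _).2 hx)
    funext j
    simp [β, this]
  obtain ⟨y, hy, hy0⟩ : ∃ y ∈ H, 0 < τ y := by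
    by_contra! h
    refine hτ ((AddSubgroup.eq_bot_iff_forall _).2 ?_)
    rintro _ ⟨y, hy, rfl⟩
    refine le_antisymm (h y hy) ?_
    simpa using h (-y) (H.neg_mem hy)
  obtain ⟨v, hvH, hv⟩ := exists_zmultiples_ge hrank (η.range ⊔ AddSubgroup.closure {y})
    (by
      have h1 : η.range.FG := (AddGroup.fg_iff_addSubgroup_fg _).1 (AddGroup.fg_range η)
      exact h1.sup ⟨{y}, by simp⟩)
    (sup_le (by rintro _ ⟨x, rfl⟩; exact hηH x) ((AddSubgroup.closure_le _).2 (by simpa using hy)))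
  obtain ⟨u₀, hu₀H, hu₀, hu₀η⟩ : ∃ u₀ ∈ H, 0 < τ u₀ ∧ ∀ x, ∃ n : ℤ, n • u₀ = η x := by
    have hv' : ∀ x, ∃ n : ℤ, n • v = η x := fun x => hv (AddSubgroup.mem_sup_left ⟨x, rfl⟩)
    obtain ⟨n, hn⟩ := hv (AddSubgroup.mem_sup_right (AddSubgroup.mem_closure_singleton_self y))
    have hvn : τ v ≠ 0 := by
      intro h
      rw [← hn] at hy0
      simp [h] at hy0
    rcases lt_or_gt_of_ne hvn with h | h
    · refine ⟨-v, H.neg_mem hvH, by simpa using h, fun x => ?_⟩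
      obtain ⟨n, hn⟩ := hv' x
      exact ⟨-n, by simpa using hn⟩
    · exact ⟨v, hvH, h, hv'⟩
  -- Replacing `u₀` by `u` with `u₀ = N₁ • u` multiplies the mean coordinate `τ x / τ u₀` by `N₁`,
  -- while the error bound `(k + 3) * ∑ |β x j|` is unchanged; `K` is how large `N₁` must be.
  obtain ⟨K, hK⟩ : ∃ K : ℕ, ∀ x : M, (x : G) ∈ S →
      ((k : ℝ) + 3) * (∑ j, |(β x j : ℝ)|) * τ u₀ ≤ K * τ x := by
    have hfin : {x : M | (x : G) ∈ S}.Finite := hSfin.preimage Subtype.val_injective.injOn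
    obtain ⟨B, hB⟩ := (hfin.image fun x : M =>
      ((k : ℝ) + 3) * (∑ j, |(β x j : ℝ)|) * τ u₀ / τ x).bddAbove
    obtain ⟨K, hK⟩ := exists_nat_ge B
    refine ⟨K, fun x hx => ?_⟩
    have := (hB (Set.mem_image_of_mem _ hx)).trans hK
    rwa [div_le_iff₀ (hS _ hx)] at this
  obtain ⟨N₁, hN₁, u, huH, hu₀u⟩ := exists_eq_nsmul hrank hcyc hu₀H
    (by rintro rfl; simp at hu₀) (K + 1)
  have hτu₀ : τ u₀ = N₁ * τ u := by rw [hu₀u]; simp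
  have hu : 0 < τ u := by
    rw [hτu₀] at hu₀
    exact pos_of_mul_pos_right hu₀ (Nat.cast_nonneg _)
  have hu_ne : u ≠ 0 := by rintro rfl; simp at hu
  -- A second division leaves room for `k + 2` distinct shifts by multiples of `h`.
  obtain ⟨N, hN, h, hhH, huh⟩ := exists_eq_nsmul hrank hcyc huH hu_ne (k + 2)
  obtain ⟨φ, w, hφ, hφ1, hφw, hwb⟩ := exists_balanced_generators τ hu hN huh fun j => (l j : G)
  have hκ : ∀ x, ∃ n : ℤ, n • u = η x := by
    intro x
    obtain ⟨n, hn⟩ := hu₀η x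
    exact ⟨n * N₁, by rw [← hn, hu₀u, mul_smul, natCast_zsmul]⟩
  choose κ hκ using hκ
  have hκadd : ∀ x y, κ (x + y) = κ x + κ y := by
    intro x y
    apply smul_left_injective ℤ hu_ne
    simp only [add_smul, hκ, map_add]
  let ψ : M →+ (Fin (k + 2) → ℤ) := AddMonoidHom.mk'
    (fun x => κ x • (fun _ => (1 : ℤ)) + ∑ j, β x j • w j) (by
      intro x y
      simp only [hβadd, hκadd, Pi.add_apply, add_smul, Finset.sum_add_distrib]
      abel)
  have hψ : ∀ x, ψ x = κ x • (fun _ => (1 : ℤ)) + ∑ j, β x j • w j := fun x => rfl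
  refine ⟨φ, ψ, hφ, hφ1 ▸ huH, fun x => ?_, fun x hx => ⟨κ x, ?_⟩, fun x hx i => ?_⟩
  · rw [hψ, map_add, map_zsmul, hφ1, hκ, map_sum]
    simp only [map_zsmul, hφw]
    exact (hη x).symm
  · rw [hψ, hβH x hx]
    funext i
    simp
  · have e1 : (ψ x i : ℝ) = κ x + ∑ j, (β x j : ℝ) * w j i := by
      rw [hψ]
      simp [Finset.sum_apply]
    have e2 : τ x / τ u = κ x + ∑ j, (β x j : ℝ) * (τ (l j) / τ u) := by
      rw [hη x, map_add, ← hκ, map_sum, add_div, Finset.sum_div]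
      simp only [map_zsmul, zsmul_eq_mul]
      rw [mul_div_assoc, div_self hu.ne', mul_one]
      simp only [mul_div_assoc]
    have e3 : |(ψ x i : ℝ) - τ x / τ u| ≤ (k + 3) * ∑ j, |(β x j : ℝ)| := by
      have : (ψ x i : ℝ) - τ x / τ u = ∑ j, (β x j : ℝ) * (w j i - τ (l j) / τ u) := by
        rw [e1, e2]
        simp only [mul_sub, Finset.sum_sub_distrib]
        ring
      rw [this, Finset.mul_sum]
      refine (Finset.abs_sum_le_sum_abs _ _).trans (Finset.sum_le_sum fun j _ => ?_)
      rw [abs_mul, mul_comm]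
      gcongr
      exact hwb j i
    have e4 : ((k : ℝ) + 3) * ∑ j, |(β x j : ℝ)| ≤ τ x / τ u := by
      have h1 := hK x hx
      rw [hτu₀] at h1
      rw [le_div_iff₀ hu]
      have h2 : (K : ℝ) + 1 ≤ N₁ := by exact_mod_cast hN₁
      have h3 := hS _ hx
      have h4 : (N₁ : ℝ) * (((k : ℝ) + 3) * (∑ j, |(β x j : ℝ)|) * τ u) ≤ N₁ * τ x := by
        nlinarith
      refine le_of_mul_le_mul_left h4 ?_
      have : (0 : ℝ) ≤ K := Nat.cast_nonneg K
      linarith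
    have e5 : (0 : ℝ) ≤ ψ x i := by linarith [(abs_le.1 e3).1]
    exact_mod_cast e5

end Step

/-! ### From compatible factorizations to a direct limit. -/

section Realization

theorem transition_self {f : ℕ → ℕ} (A : ∀ n, Matrix (Fin (f (n + 1))) (Fin (f n)) ℤ) (m : ℕ)
    (v : Fin (f m) → ℤ) : transition A m m le_rfl v = v := by
  simp [transition, Nat.leRecOn_self]

theorem transition_succ {f : ℕ → ℕ} (A : ∀ n, Matrix (Fin (f (n + 1))) (Fin (f n)) ℤ) {m n : ℕ}
    (h : m ≤ n) (v : Fin (f m) → ℤ) :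
    transition A m (n + 1) (h.trans n.le_succ) v = (A n).mulVec (transition A m n h v) := by
  rw [transition, Nat.leRecOn_succ h]
  rfl

theorem limitClass_mulVec {f : ℕ → ℕ} (A : ∀ n, Matrix (Fin (f (n + 1))) (Fin (f n)) ℤ) (n : ℕ)
    (v : Fin (f n) → ℤ) : limitClass A (n + 1) ((A n).mulVec v) = limitClass A n v := by
  have h := AddCommGroup.DirectLimit.of_f (G := fun n => Fin (f n) → ℤ) (f := transition A)
    n.le_succ v
  rwa [transition_succ A le_rfl, transition_self] at h

variable {G : Type*} [AddCommGroup G] [PartialOrder G] [IsOrderedAddMonoid G]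

/-- An exhausting sequence of subgroups that factor compatibly through `ℤ ^ f n` yields an
equal row sum realization. -/
theorem exists_realization_of_factorizations (H : AddSubgroup G) (f : ℕ → ℕ) (hf : ∀ n, 0 < f n)
    (M : ℕ → AddSubgroup G) (φ : ∀ n, (Fin (f n) → ℤ) →+ G) (ψ : ∀ n, M n →+ (Fin (f n) → ℤ))
    (hφM : ∀ n v, φ n v ∈ M (n + 1)) (hφψ : ∀ n x, φ n (ψ n x) = x)
    (hφ_pos : ∀ n i, 0 < φ n (Pi.single i 1)) (hφH : ∀ n, φ n (fun _ => 1) ∈ H)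
    (hψH : ∀ n (x : M n), (x : G) ∈ H → ∃ z : ℤ, ψ n x = fun _ => z)
    (hψφ : ∀ n j i, 0 ≤ ψ (n + 1) ⟨φ n (Pi.single j 1), hφM n _⟩ i)
    (hM : ∀ x : G, ∃ n, x ∈ M n)
    (hψ_nonneg : ∀ x : G, 0 < x → ∃ (n : ℕ) (hx : x ∈ M n), ∀ i, 0 ≤ ψ n ⟨x, hx⟩ i) :
    ∃ R : ERSRealization G H, ∀ n, R.size n = f n := by
  classical
  let T : ∀ n, (Fin (f n) → ℤ) →+ (Fin (f (n + 1)) → ℤ) := fun n =>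
    (ψ (n + 1)).comp ((φ n).codRestrict (M (n + 1)) (hφM n))
  have hT : ∀ n v, T n v = ψ (n + 1) ⟨φ n v, hφM n v⟩ := fun n v => rfl
  have hφT : ∀ n v, φ (n + 1) (T n v) = φ n v := fun n v => hφψ _ _
  let A : ∀ n, Matrix (Fin (f (n + 1))) (Fin (f n)) ℤ := fun n =>
    LinearMap.toMatrix' (T n).toIntLinearMap
  have hA : ∀ n v, (A n).mulVec v = T n v := by
    intro n v
    change (LinearMap.toMatrix' (T n).toIntLinearMap).mulVec v = T n v
    rw [LinearMap.toMatrix'_mulVec]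
    rfl
  have hone : ∀ n, 0 < φ n (fun _ => 1) := by
    intro n
    have h1 : (fun _ => 1 : Fin (f n) → ℤ) = ∑ i, Pi.single i 1 := by
      rw [Finset.univ_sum_single]
    rw [h1, map_sum]
    have : Nonempty (Fin (f n)) := ⟨⟨0, hf n⟩⟩
    exact Finset.sum_pos (fun i _ => hφ_pos n i) Finset.univ_nonempty
  choose p hp using fun n => hψH (n + 1) ⟨φ n (fun _ => 1), hφM n _⟩ (hφH n)
  have hp_pos : ∀ n, 0 < p n := by
    intro n
    by_contra! hle
    have h1 : φ n (fun _ => 1) = p n • φ (n + 1) (fun _ => 1) := by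
      rw [← hφT n, hT, hp, ← map_zsmul]
      congr 1
      funext i
      simp
    have h2 : 0 ≤ (-p n) • φ (n + 1) (fun _ => 1) := zsmul_nonneg (hone _).le (by omega)
    rw [neg_smul, ← h1] at h2
    exact (hone n).not_ge (by simpa using h2)
  have hcompat : ∀ i j (hij : i ≤ j) v, φ j (transition A i j hij v) = φ i v := by
    intro i j hij v
    induction j, hij using Nat.le_induction with
    | base => rw [transition_self]
    | succ j hij ih => rw [transition_succ A hij, hA, hφT, ih]
  let L : MatrixLimit A →+ G := AddCommGroup.DirectLimit.lift _ (transition A) G φ hcompat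
  have hL : ∀ n v, L (limitClass A n v) = φ n v := fun n v =>
    AddCommGroup.DirectLimit.lift_of (f := transition A) G φ hcompat n v
  -- `T n v` depends only on `φ n v`, so whatever dies in `G` dies one stage later.
  have hL_inj : Function.Injective L := by
    rw [injective_iff_map_eq_zero]
    intro x
    induction x using AddCommGroup.DirectLimit.induction_on with
    | _ n v =>
      intro hx
      rw [hL] at hx
      change limitClass A n v = 0
      rw [← limitClass_mulVec, hA, hT]
      have : (⟨φ n v, hφM n v⟩ : M (n + 1)) = 0 := Subtype.ext hx
      rw [this, map_zero, map_zero]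
  have hL_surj : Function.Surjective L := by
    intro x
    obtain ⟨n, hn⟩ := hM x
    exact ⟨limitClass A n (ψ n ⟨x, hn⟩), by rw [hL, hφψ]⟩
  let e : MatrixLimit A ≃+ G := AddEquiv.ofBijective L ⟨hL_inj, hL_surj⟩
  have he : ∀ n v, e.symm (φ n v) = limitClass A n v := by
    intro n v
    rw [AddEquiv.symm_apply_eq]
    exact (hL n v).symm
  refine ⟨{ size := f, size_pos := hf, mat := A, mat_nonneg := ?_, rowSum := p,
            rowSum_pos := hp_pos, sum_row := ?_, iso := e.symm, iso_order := ?_,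
            iso_image := ?_ }, fun n => rfl⟩
  · intro n i j
    change 0 ≤ LinearMap.toMatrix' (T n).toIntLinearMap i j
    rw [LinearMap.toMatrix'_apply]
    exact hψφ n j i
  · intro n i
    have h1 := congrFun ((hA n (fun _ => 1)).trans ((hT n _).trans (hp n))) i
    rw [← h1]
    simp [Matrix.mulVec, dotProduct]
  · intro g
    constructor
    · intro hg
      rcases hg.eq_or_lt with rfl | hg
      · exact ⟨0, 0, fun _ => le_rfl, by simp⟩
      · obtain ⟨n, hn, hψn⟩ := hψ_nonneg g hg
        refine ⟨n, ψ n ⟨g, hn⟩, hψn, ?_⟩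
        rw [← he, hφψ]
    · rintro ⟨n, v, hv, hg⟩
      have h1 : g = φ n v := by
        rw [← he] at hg
        exact e.symm.injective hg
      have h2 : v = ∑ i, v i • Pi.single i (1 : ℤ) := by
        conv_lhs => rw [← Finset.univ_sum_single v]
        refine Finset.sum_congr rfl fun i _ => ?_
        rw [← Pi.single_smul, smul_eq_mul, mul_one]
      rw [h1, h2, map_sum]
      refine Finset.sum_nonneg fun i _ => ?_
      rw [map_zsmul]
      exact zsmul_nonneg (hφ_pos n i).le (hv i)
  · ext x
    simp only [Set.mem_image, SetLike.mem_coe, Set.mem_iUnion, Set.mem_ofPred_eq]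
    constructor
    · rintro ⟨h, hh, rfl⟩
      obtain ⟨n, hn⟩ := hM h
      obtain ⟨z, hz⟩ := hψH n ⟨h, hn⟩ hh
      refine ⟨n, z, ?_⟩
      have h1 : φ n (z • fun _ => 1) = h := by
        have : (z • fun _ => 1 : Fin (f n) → ℤ) = ψ n ⟨h, hn⟩ := by
          rw [hz]; funext i; simp
        rw [this, hφψ]
      rw [← map_zsmul, ← he, h1]
    · rintro ⟨n, z, rfl⟩
      refine ⟨z • φ n (fun _ => 1), H.zsmul_mem (hφH n) z, ?_⟩
      rw [map_zsmul, he]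

end Realization

/-! ### Exhausting a countable group. -/

section Exhaustion

variable {G : Type*} [AddCommGroup G] [PartialOrder G] [IsOrderedAddMonoid G] [Countable G]
  {H : AddSubgroup G}

/-- Existence of realizations with sizes governed by an increasing sequence of finitely generated
subgroups that starts at a prescribed one. -/
theorem exists_realization_of_fg [IsAddTorsionFree G] {τ : G →+ ℝ}
    (hpos : ∀ g : G, 0 < g ↔ 0 < τ g)
    (hrank : Module.rank ℤ H = 1) (hcyc : ¬ IsAddCyclic H)
    (hτ : H.map τ ≠ ⊥) (htf : IsAddTorsionFree (G ⧸ H)) (M₀ : AddSubgroup G) (hM₀ : M₀.FG) :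
    ∃ M : ℕ → AddSubgroup G, (∀ n, M₀ ≤ M n) ∧ (∀ n, (M n).FG) ∧
      ∃ R : ERSRealization G H,
        ∀ n, R.size n = Module.finrank ℤ ((M n).map (QuotientAddGroup.mk' H)) + 2 := by
  classical
  obtain ⟨x, hx⟩ := exists_surjective_nat G
  let St := {p : AddSubgroup G × Set G // p.1.FG ∧ p.2.Finite ∧ ∀ x ∈ p.2, 0 < τ x}
  choose φ ψ hφpos hφH hφψ hψH hψS using fun s : St =>
    exists_factorization τ hrank hcyc hτ htf s.1.1 s.2.1 s.1.2 s.2.2.1 s.2.2.2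
  -- The test set receives the images of the basis vectors, to make the next matrix nonnegative, and
  -- `x n` when it has positive trace, to make its positivity visible in the limit.
  let next : ℕ → St → St := fun n s =>
    ⟨((φ s).range ⊔ AddSubgroup.closure {x n},
      s.1.2 ∪ ({y | y = x n ∧ 0 < τ y} ∪ Set.range fun i => φ s (Pi.single i 1))),
      ((AddGroup.fg_iff_addSubgroup_fg _).1 (AddGroup.fg_range (φ s))).sup ⟨{x n}, by simp⟩,
      s.2.2.1.union (((Set.finite_singleton (x n)).subset (fun y hy => hy.1)).union
        (Set.finite_range _)), by
      rintro y (hy | hy | ⟨i, rfl⟩)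
      · exact s.2.2.2 y hy
      · exact hy.2
      · exact hφpos s i⟩
  let s₀ : St := ⟨(M₀, ∅), hM₀, Set.finite_empty, by simp⟩
  let st : ℕ → St := fun n => Nat.rec s₀ next n
  have hφM : ∀ n v, φ (st n) v ∈ (st (n + 1)).1.1 := fun n v =>
    AddSubgroup.mem_sup_left ⟨v, rfl⟩
  have hxM : ∀ n, x n ∈ (st (n + 1)).1.1 := fun n =>
    AddSubgroup.mem_sup_right (AddSubgroup.mem_closure_singleton_self _)
  have hmono : Monotone fun n => (st n).1.1 := by
    refine monotone_nat_of_le_succ fun n y hy => ?_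
    have := hφM n (ψ (st n) ⟨y, hy⟩)
    rwa [hφψ] at this
  refine ⟨fun n => (st n).1.1, fun n => hmono (Nat.zero_le n), fun n => (st n).2.1, ?_⟩
  refine exists_realization_of_factorizations H _ (fun n => Nat.succ_pos _)
    (fun n => (st n).1.1) (fun n => φ (st n)) (fun n => ψ (st n)) hφM (fun n => hφψ (st n))
    (fun n i => (hpos _).2 (hφpos (st n) i)) (fun n => hφH (st n)) (fun n => hψH (st n))
    (fun n j i => hψS (st (n + 1)) _ (Or.inr (Or.inr ⟨j, rfl⟩)) i) (fun y => ?_) (fun y hy => ?_)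
  · obtain ⟨n, rfl⟩ := hx y
    exact ⟨n + 1, hxM n⟩
  · obtain ⟨n, rfl⟩ := hx y
    exact ⟨n + 1, hxM n, hψS (st (n + 1)) ⟨x n, hxM n⟩ (Or.inr (Or.inl ⟨rfl, (hpos _).1 hy⟩))⟩

end Exhaustion

/-! ### Keeping the rank modulo `H` constant. -/

section Rank

variable {G : Type*} [AddCommGroup G] {H : AddSubgroup G}

theorem rank_quotient_eq (hrank : Module.rank ℤ H = 1) {k : ℕ}
    (hk : Module.rank ℤ G = ((k + 1 : ℕ) : Cardinal)) : Module.rank ℤ (G ⧸ H) = k := by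
  have h : Module.rank ℤ (G ⧸ H) + Module.rank ℤ H = Module.rank ℤ G :=
    rank_quotient_add_rank_of_isDomain (AddSubgroup.toIntSubmodule H)
  rw [hrank, hk, Nat.cast_add, Nat.cast_one] at h
  exact Cardinal.add_one_inj.1 h

/-- In a quotient of finite rank, some finitely generated subgroup has an image of full rank, and
so has every larger one. -/
theorem exists_fg_finrank_map_eq {k : ℕ} (hk : Module.rank ℤ (G ⧸ H) = k) :
    ∃ M₀ : AddSubgroup G, M₀.FG ∧ ∀ M : AddSubgroup G, M₀ ≤ M → M.FG →
      Module.finrank ℤ (M.map (QuotientAddGroup.mk' H)) = k := by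
  classical
  obtain ⟨s, hs, hli⟩ := exists_finset_linearIndependent_of_le_rank hk.ge
  refine ⟨AddSubgroup.closure (s.image Quotient.out : Finset G), ⟨_, rfl⟩, fun M hM hfg => ?_⟩
  let F : Submodule ℤ (G ⧸ H) := AddSubgroup.toIntSubmodule (M.map (QuotientAddGroup.mk' H))
  change Module.finrank ℤ F = k
  have hFfg : Module.Finite ℤ F := by
    have : AddGroup.FG M := (AddGroup.fg_iff_addSubgroup_fg M).2 hfg
    exact Module.Finite.iff_addGroup_fg.2 (AddGroup.fg_of_surjective
      (AddMonoidHom.addSubgroupMap_surjective (QuotientAddGroup.mk' H) M))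
  apply le_antisymm
  · have h1 : Module.rank ℤ F ≤ k := (Submodule.rank_le F).trans_eq hk
    exact Module.finrank_le_of_rank_le h1
  · have hle : Submodule.span ℤ (s : Set (G ⧸ H)) ≤ F := by
      rw [Submodule.span_le]
      intro q hq
      refine ⟨Quotient.out q, hM (AddSubgroup.subset_closure ?_), Quotient.out_eq' q⟩
      exact Finset.mem_coe.2 (Finset.mem_image_of_mem _ hq)
    have h1 := Submodule.finrank_mono hle
    rwa [finrank_span_finset_eq_card hli, hs] at h1

end Rank

/-! ### Near splitting. -/

section NearlySplit

variable {G : Type*} [AddCommGroup G] {H : AddSubgroup G}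

/-- If `t` is injective on `H` and `G ⧸ H` is finitely generated, then the kernel of `t` nearly
splits off. -/
theorem nearlySplit_of_fg_quotient {V : Type*} [AddCommGroup V] (t : G →+ V)
    (hinj : ∀ x ∈ H, t x = 0 → x = 0) (hfg : AddGroup.FG (G ⧸ H)) : NearlySplit t := by
  -- The purification of `H + ker t`. Its quotient is finitely generated and torsion-free, hence
  -- free, so `P` has a complement `C`.
  let P : AddSubgroup G :=
    { carrier := {x | ∃ n : ℤ, n ≠ 0 ∧ ∃ h ∈ H, t (n • x) = t h}
      zero_mem' := ⟨1, one_ne_zero, 0, H.zero_mem, by simp⟩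
      add_mem' := by
        rintro a b ⟨n, hn, h, hh, e⟩ ⟨m, hm, h', hh', e'⟩
        refine ⟨n * m, mul_ne_zero hn hm, m • h + n • h',
          H.add_mem (H.zsmul_mem hh _) (H.zsmul_mem hh' _), ?_⟩
        rw [map_add, map_zsmul _ m, map_zsmul _ n, ← e, ← e']
        simp only [map_zsmul, map_add]
        module
      neg_mem' := by
        rintro a ⟨n, hn, h, hh, e⟩
        exact ⟨n, hn, -h, H.neg_mem hh, by simp [← e]⟩ }
  have hHP : H ≤ P := fun h hh => ⟨1, one_ne_zero, h, hh, by simp⟩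
  have hKP : t.ker ≤ P := fun x hx =>
    ⟨1, one_ne_zero, 0, H.zero_mem, by simpa using AddMonoidHom.mem_ker.1 hx⟩
  have hPdiv : ∀ (n : ℤ) (x : G), n ≠ 0 → n • x ∈ P → x ∈ P := by
    rintro n x hn ⟨m, hm, h, hh, e⟩
    exact ⟨m * n, mul_ne_zero hm hn, h, hh, by rw [mul_smul]; exact e⟩
  have : AddGroup.FG (G ⧸ P) := AddGroup.fg_of_surjective
    (f := QuotientAddGroup.map H P (AddMonoidHom.id G) hHP) (by
      intro q
      induction q using QuotientAddGroup.induction_on with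
      | H x => exact ⟨(x : G ⧸ H), rfl⟩)
  have : Module.Finite ℤ (G ⧸ P) := Module.Finite.iff_addGroup_fg.2 this
  have : Module.IsTorsionFree ℤ (G ⧸ P) := by
    refine .of_smul_eq_zero fun n q hq => ?_
    induction q using QuotientAddGroup.induction_on with
    | H x =>
      by_cases hn : n = 0
      · exact Or.inl hn
      · refine Or.inr ((QuotientAddGroup.eq_zero_iff x).2 (hPdiv n x hn ?_))
        exact (QuotientAddGroup.eq_zero_iff _).1 hq
  have : Module.Free ℤ (G ⧸ P) := Module.free_of_finite_type_torsion_free'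
  obtain ⟨s, hs⟩ := Module.projective_lifting_property
    (QuotientAddGroup.mk' P).toIntLinearMap (LinearMap.id (R := ℤ) (M := G ⧸ P))
    (QuotientAddGroup.mk'_surjective P)
  have hs' : ∀ q, QuotientAddGroup.mk' P (s q) = q := fun q => LinearMap.congr_fun hs q
  let C : AddSubgroup G := s.toAddMonoidHom.range
  have hC : ∀ c ∈ C, c ∈ P → c = 0 := by
    rintro _ ⟨q, rfl⟩ hq
    have h1 : q = 0 := (hs' q).symm.trans ((QuotientAddGroup.eq_zero_iff _).2 hq)
    rw [h1]
    simp
  refine ⟨_, H ⊔ C, ?_, rfl, ?_⟩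
  · rw [AddSubgroup.disjoint_def]
    intro x hx hx'
    obtain ⟨h, hh, c, hc, rfl⟩ := AddSubgroup.mem_sup.1 hx'
    have hc0 : c = 0 := hC c hc (by
      simpa using P.sub_mem (hKP hx) (hHP hh))
    subst hc0
    rw [add_zero] at hx ⊢
    exact hinj h hh hx
  · rw [AddSubgroup.finiteIndex_iff_finite_quotient]
    set J := t.ker ⊔ (H ⊔ C)
    have hHJ : H ≤ J := le_sup_left.trans le_sup_right
    have hCJ : C ≤ J := le_sup_right.trans le_sup_right
    have : AddGroup.FG (G ⧸ J) := AddGroup.fg_of_surjective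
      (f := QuotientAddGroup.map H J (AddMonoidHom.id G) hHJ) (by
        intro q
        induction q using QuotientAddGroup.induction_on with
        | H x => exact ⟨(x : G ⧸ H), rfl⟩)
    -- Modulo `C` every `x` lies in `P`, and a nonzero multiple of an element of `P` lies in `H +
    -- ker t`; so the quotient is torsion.
    refine AddCommGroup.finite_of_fg_isAddTorsion _ fun q => ?_
    induction q using QuotientAddGroup.induction_on with
    | H x =>
      set c : G := s (QuotientAddGroup.mk' P x) with hc
      have hcC : c ∈ C := ⟨_, rfl⟩
      have hxc : x - c ∈ P := by
        rw [← QuotientAddGroup.eq_zero_iff]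
        change QuotientAddGroup.mk' P (x - c) = 0
        rw [map_sub, hc, hs', sub_self]
      obtain ⟨n, hn, h, hh, e⟩ := hxc
      rw [isOfFinAddOrder_iff_zsmul_eq_zero]
      refine ⟨n, hn, ?_⟩
      change ((n • x : G) : G ⧸ J) = 0
      rw [QuotientAddGroup.eq_zero_iff]
      have h1 : n • x = (n • (x - c) - h) + (h + n • c) := by module
      rw [h1]
      refine J.add_mem (AddSubgroup.mem_sup_left ?_)
        (J.add_mem (hHJ hh) (J.zsmul_mem (hCJ hcC) n))
      rw [AddMonoidHom.mem_ker, map_sub, e, sub_self]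

end NearlySplit

/-- Unperforation applies to both `x` and `-x` when `n • x = 0`. -/
theorem IsDimensionGroup.isAddTorsionFree {G : Type*} [AddCommGroup G] [PartialOrder G]
    [IsOrderedAddMonoid G] (hG : IsDimensionGroup G) : IsAddTorsionFree G := by
  refine ⟨fun n hn => ?_⟩
  change Function.Injective (nsmulAddMonoidHom n : G →+ G)
  rw [injective_iff_map_eq_zero]
  intro x hx
  have hx' : n • x = 0 := hx
  refine le_antisymm ?_ (hG.unperforated n x (Nat.pos_of_ne_zero hn) hx'.ge)
  simpa using hG.unperforated n (-x) (Nat.pos_of_ne_zero hn) (by simp [hx'])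

end ERS

theorem theorem7p1 {G : Type*} [AddCommGroup G] [PartialOrder G] [IsOrderedAddMonoid G]
    [Countable G] (hG : ERS.IsSimpleDimensionGroup G)
    (τ : G →+ ℝ) (hτ : ERS.IsUniqueTrace τ)
    (H : AddSubgroup G) (hH_rank : Module.rank ℤ H = 1) (hH_cyc : ¬ IsAddCyclic H)
    (hH_tr : H.map τ ≠ ⊥) (hH_tf : IsAddTorsionFree (G ⧸ H)) :
    (∀ k : ℕ, Module.rank ℤ G = ((k + 1 : ℕ) : Cardinal) →
      (∃ R : ERS.ERSRealization G H, ∀ n, R.size n = k + 2) ∧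
      (Module.Free ℤ (G ⧸ H) → ERS.NearlySplit τ)) ∧
    Nonempty (ERS.ERSRealization G H) := by
  have : IsAddTorsionFree G := hG.isAddTorsionFree
  have key := ERS.exists_realization_of_fg (hG.pos_iff hτ) hH_rank hH_cyc hH_tr hH_tf
  refine ⟨fun k hk => ?_, ?_⟩
  · have hq := ERS.rank_quotient_eq hH_rank hk
    refine ⟨?_, fun hfree => ?_⟩
    · obtain ⟨M₀, hM₀, hfull⟩ := ERS.exists_fg_finrank_map_eq hq
      obtain ⟨M, hM, hMfg, R, hR⟩ := key M₀ hM₀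
      exact ⟨R, fun n => by rw [hR, hfull (M n) (hM n) (hMfg n)]⟩
    -- Freeness serves only to turn finite rank into finite generation.
    · have : Module.Finite ℤ (G ⧸ H) := Module.finite_of_rank_eq_nat hq
      exact ERS.nearlySplit_of_fg_quotient τ
        (fun x hx h0 => ERS.eq_zero_of_map_eq_zero hH_rank τ hH_tr hx h0)
        (Module.Finite.iff_addGroup_fg.1 this)
  · obtain ⟨M, -, -, R, -⟩ := key ⊥ ⟨∅, by simp⟩
    exact ⟨R⟩
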